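/- Let $0<a<b\le\frac12$, and let $P_X=\mathrm{Bern}(a)$ and $P_Y=\mathrm{Bern}(b)$ on $\{0,1\}$, where $\mathrm{Bern}(p)$ gives mass $p$ to $1$ and mass $1-p$ to $0$. For $n\ge1$ and $t\in\mathbb R$ let $$\mathcal G_t(P_X^n,P_Y^n):=\inf_{\pi}\ \pi\Big\{(x^n,y^n):\ \frac1n\sum_{i=1}^n 1\{x_i\ne y_i\}>t\Big\},$$ where the infimum is over all couplings $\pi$ of the product measures $P_X^n$ and $P_Y^n$, i.e. all probability measures on $\{0,1\}^n\times\{0,1\}^n$ with marginals $P_X^n$ and $P_Y^n$. Put $\alpha=b-a$, and let $(a_n)_{n\ge1}$ be a positive sequence with $a_n\to0$ and $na_n\to\infty$ as $n\to\infty$. Then the following hold. 1. If $\Delta<0$, then $$\lim_{n\to\infty}-a_n\log\Big(1-\mathcal G_{\alpha+\frac{\Delta}{\sqrt{na_n}}}(P_X^n,P_Y^n)\Big)=\frac{\hat a^{*2}}{2(a-a^2)},\qquad \hat a^{*}=\frac{-\Delta}{\sqrt{\frac{b-b^2}{a-a^2}}+1}.$$ 2. If $\Delta>0$, then $$\lim_{n\to\infty}-a_n\log\mathcal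 G_{\alpha+\frac{\Delta}{\sqrt{na_n}}}(P_X^n,P_Y^n)=\frac{a^{*2}}{2(a-a^2)},\qquad a^{*}=\frac{\Delta}{\sqrt{\frac{b-b^2}{a-a^2}}-1}.$$ -/

import Mathlib

open MeasureTheory ProbabilityTheory Filter Topology
open scoped ENNReal

noncomputable section

namespace StrassenOT

/-- The couplings of `μ` and `ν`: the measures on the product space whose two marginals are
`μ` and `ν`. For probability measures `μ` and `ν` every coupling is a probability measure. -/
def couplings {X Y : Type*} [MeasurableSpace X] [MeasurableSpace Y]
    (μ : Measure X) (ν : Measure Y) : Set (Measure (X × Y)) :=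
  {π | π.map Prod.fst = μ ∧ π.map Prod.snd = ν}

/-- The optimal excess-cost probability `𝒢_α(μ, ν) = inf_π π{(x, y) : c(x, y) > α}`, the infimum
being over all couplings `π` of `μ` and `ν`. -/
def excessCostProb {X Y : Type*} [MeasurableSpace X] [MeasurableSpace Y]
    (c : X → Y → ℝ) (α : ℝ) (μ : Measure X) (ν : Measure Y) : ℝ≥0∞ :=
  ⨅ π ∈ couplings μ ν, π {p | α < c p.1 p.2}

/-- The additive cost `c_n(x^n, y^n) = (1/n) ∑ i, c(x_i, y_i)` on `n`-tuples. -/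
def avgCost {X Y : Type*} (c : X → Y → ℝ) (n : ℕ) (x : Fin n → X) (y : Fin n → Y) : ℝ :=
  (1 / (n : ℝ)) * ∑ i, c (x i) (y i)

/-- The Hamming cost `1{x ≠ y}` on the binary alphabet `{0, 1}`. -/
def hammingCost (x y : Fin 2) : ℝ := if x ≠ y then 1 else 0

/-- The Bernoulli distribution `Bern(p)` on `{0, 1}`: mass `p` at `1` and mass `1 - p` at `0`. -/
def bern (p : unitInterval) : Measure (Fin 2) := bernoulliMeasure 1 0 p

/-- `𝒢_α(P_X^n, P_Y^n)` for `P_X = Bern(a)`, `P_Y = Bern(b)` and the additive Hamming cost on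
`{0, 1}^n`, as a real number. -/
def binaryECP (a b : unitInterval) (n : ℕ) (α : ℝ) : ℝ :=
  (excessCostProb (avgCost hammingCost n) α
    (Measure.pi fun _ : Fin n => bern a) (Measure.pi fun _ : Fin n => bern b)).toReal

end StrassenOT

end

/-! Everything reduces to the numbers of ones X and Y. The Hamming distance of two strings is at
least |X - Y|, with equality for strings of the form 1...10...0. Since Bernoulli products are
exchangeable, applying one uniformly random permutation to two such strings lifts any coupling of
the binomial weights to a coupling of the products, at cost |X - Y| (`binaryECP_le`,
`le_binaryECP`). X ≥ Y has negligible probability, the means being na < nb.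

Put η = 1/√(n s), so that nη² = 1/s. At scale nη a binomial tail at deviation c has probability
exp(-(c²/(2p(1-p)) + o(1)) nη²) (`upper_tail_le`, `le_upper_tail`). Let R > 1 be the ratio of the
standard deviations of Y and X.

For Δ < 0, success (cost at most the threshold) forces X up by v or Y down by Rv, where v(R+1) = -Δ
makes the two exponents equal. A union bound gives one inequality; the countermonotone coupling
makes both deviations occur together and gives the other.

For Δ > 0, the comonotone coupling roughly pairs deviation x of X with Rx of Y, so excess needs
(R-1)x > Δ. Conversely, under any coupling P(excess) ≥ P(Y > y) - P(X ≥ x) with y - x = nt; slightly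
beyond the critical deviation the second term is exponentially smaller. The upper bound compares the
two distribution functions at finitely many grid points (`lower_prob_le`). -/

namespace StrassenOT

/-! ### Binomial probabilities: tilting, Chernoff and Chebyshev bounds -/

/-- The binomial weight `C(n, k) p ^ k (1 - p) ^ (n - k)`. -/
noncomputable def binomialWeight (n : ℕ) (p : ℝ) (k : ℕ) : ℝ :=
  n.choose k * p ^ k * (1 - p) ^ (n - k)

/-- The probability that a binomial variable with parameters `n` and `p` lies in `A`. -/
noncomputable def binomialProb (n : ℕ) (p : ℝ) (A : Set ℕ) : ℝ :=
  ∑ k ∈ Finset.range (n + 1), A.indicator (binomialWeight n p) k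

lemma binomialWeight_nonneg {p : ℝ} (h0 : 0 ≤ p) (h1 : p ≤ 1) (n k : ℕ) :
    0 ≤ binomialWeight n p k := by
  have : 0 ≤ 1 - p := by linarith
  unfold binomialWeight
  positivity

lemma binomialProb_nonneg {p : ℝ} (h0 : 0 ≤ p) (h1 : p ≤ 1) (n : ℕ) (A : Set ℕ) :
    0 ≤ binomialProb n p A :=
  Finset.sum_nonneg fun _ _ => Set.indicator_nonneg (fun _ _ => binomialWeight_nonneg h0 h1 _ _) _

lemma binomialProb_mono {p : ℝ} (h0 : 0 ≤ p) (h1 : p ≤ 1) (n : ℕ) {A B : Set ℕ} (h : A ⊆ B) :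
    binomialProb n p A ≤ binomialProb n p B :=
  Finset.sum_le_sum fun _ _ =>
    Set.indicator_le_indicator_of_subset h (fun _ => binomialWeight_nonneg h0 h1 _ _) _

lemma binomialProb_univ (n : ℕ) (p : ℝ) : binomialProb n p Set.univ = 1 := by
  have h := add_pow p (1 - p) n
  simp only [add_sub_cancel, one_pow] at h
  rw [h]
  refine Finset.sum_congr rfl fun k _ => ?_
  simp only [Set.indicator_univ, binomialWeight]
  ring

lemma binomialProb_empty (n : ℕ) (p : ℝ) : binomialProb n p ∅ = 0 := by
  simp [binomialProb]

lemma binomialProb_compl (n : ℕ) (p : ℝ) (A : Set ℕ) :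
    binomialProb n p A + binomialProb n p Aᶜ = 1 := by
  rw [← binomialProb_univ n p, binomialProb, binomialProb, ← Finset.sum_add_distrib]
  exact Finset.sum_congr rfl fun k _ => by
    simp

lemma binomialProb_le_one {p : ℝ} (h0 : 0 ≤ p) (h1 : p ≤ 1) (n : ℕ) (A : Set ℕ) :
    binomialProb n p A ≤ 1 := by
  linarith [binomialProb_compl n p A, binomialProb_nonneg h0 h1 n Aᶜ]

lemma binomialProb_congr {n : ℕ} {p : ℝ} {A B : Set ℕ} (h : ∀ k ≤ n, k ∈ A ↔ k ∈ B) :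
    binomialProb n p A = binomialProb n p B := by
  classical
  refine Finset.sum_congr rfl fun k hk => ?_
  simp only [Set.indicator_apply, h k (Finset.mem_range_succ_iff.1 hk)]

lemma binomialProb_reflect (n : ℕ) (p : ℝ) (A : Set ℕ) :
    binomialProb n p A = binomialProb n (1 - p) {k | n - k ∈ A} := by
  classical
  unfold binomialProb
  rw [← Finset.sum_range_reflect]
  refine Finset.sum_congr rfl fun k hk => ?_
  have hk' : k ≤ n := Finset.mem_range_succ_iff.1 hk
  have e : n + 1 - 1 - k = n - k := by omega
  rw [e]
  simp only [Set.indicator_apply, Set.mem_ofPred_eq, binomialWeight]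
  rw [Nat.choose_symm hk', Nat.sub_sub_self hk', sub_sub_cancel]
  congr 1
  ring

/-- Exponential tilting of the binomial weights. -/
lemma binomialWeight_tilt {n k : ℕ} (hk : k ≤ n) {p l : ℝ} (hM : 0 < p * Real.exp l + (1 - p)) :
    binomialWeight n p k = (p * Real.exp l + (1 - p)) ^ n * Real.exp (-(l * k)) *
      binomialWeight n (p * Real.exp l / (p * Real.exp l + (1 - p))) k := by
  set M := p * Real.exp l + (1 - p) with hMd
  have h1 : 1 - p * Real.exp l / M = (1 - p) / M := by
    field_simp
    rw [hMd]; ring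
  have h2 : Real.exp (-(l * k)) * Real.exp l ^ k = 1 := by
    rw [← Real.exp_nat_mul, ← Real.exp_add]
    simp [mul_comm]
  have h3 : M ^ n = M ^ k * M ^ (n - k) := by
    rw [← pow_add]; congr 1; omega
  unfold binomialWeight
  rw [h1, h3, div_pow, div_pow, mul_pow]
  field_simp
  linear_combination (-(n.choose k : ℝ) * p ^ k * (1 - p) ^ (n - k)) * h2

lemma tiltedParam_mem {p l : ℝ} (h0 : 0 < p) (h1 : p < 1) :
    0 ≤ p * Real.exp l / (p * Real.exp l + (1 - p)) ∧
      p * Real.exp l / (p * Real.exp l + (1 - p)) ≤ 1 := by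
  have h2 : 0 < p * Real.exp l := by positivity
  have h3 : 0 < p * Real.exp l + (1 - p) := by linarith
  exact ⟨by positivity, by rw [div_le_one h3]; linarith⟩

lemma binomialProb_chernoff (n : ℕ) {p l : ℝ} (h0 : 0 < p) (h1 : p < 1) (hl : 0 ≤ l) (x : ℝ) :
    binomialProb n p {k | x ≤ k} ≤ (p * Real.exp l + (1 - p)) ^ n * Real.exp (-(l * x)) := by
  classical
  have h2 : 0 < p * Real.exp l := by positivity
  have h3 : 0 < p * Real.exp l + (1 - p) := by linarith
  obtain ⟨hq0, hq1⟩ := tiltedParam_mem (l := l) h0 h1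
  refine le_trans ?_ (mul_le_of_le_one_right (by positivity) (binomialProb_le_one hq0 hq1 n {k | x ≤ k}))
  unfold binomialProb
  rw [Finset.mul_sum]
  refine Finset.sum_le_sum fun k hk => ?_
  simp only [Set.indicator_apply, Set.mem_ofPred_eq]
  split_ifs with h
  · rw [binomialWeight_tilt (Finset.mem_range_succ_iff.1 hk) h3]
    have := binomialWeight_nonneg hq0 hq1 n k
    gcongr
  · simp

/-- On a window below `y` the tilting density is at least its value at `y`; a lower bound then only
needs the tilted law to charge the window. -/
lemma binomialProb_tilt_lower (n : ℕ) {p l : ℝ} (h0 : 0 < p) (h1 : p < 1) (hl : 0 ≤ l) (x y : ℝ) :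
    (p * Real.exp l + (1 - p)) ^ n * Real.exp (-(l * y)) *
      binomialProb n (p * Real.exp l / (p * Real.exp l + (1 - p))) {k | x < k ∧ k ≤ y} ≤
    binomialProb n p {k | x < k} := by
  classical
  have h2 : 0 < p * Real.exp l := by positivity
  have h3 : 0 < p * Real.exp l + (1 - p) := by linarith
  obtain ⟨hq0, hq1⟩ := tiltedParam_mem (l := l) h0 h1
  refine le_trans ?_ (binomialProb_mono h0.le h1.le n (A := {k | x < k ∧ k ≤ y}) fun k hk => hk.1)
  unfold binomialProb
  rw [Finset.mul_sum]
  refine Finset.sum_le_sum fun k hk => ?_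
  simp only [Set.indicator_apply, Set.mem_ofPred_eq]
  split_ifs with h
  · rw [binomialWeight_tilt (Finset.mem_range_succ_iff.1 hk) h3]
    have := binomialWeight_nonneg hq0 hq1 n k
    have h4 := h.2
    gcongr
  · simp

lemma binomialWeight_variance (n : ℕ) (p : ℝ) :
    ∑ k ∈ Finset.range (n + 1), (n * p - k) ^ 2 * binomialWeight n p k = n * p * (1 - p) := by
  have := congrArg (Polynomial.eval p) (bernsteinPolynomial.variance ℝ n)
  simpa [Polynomial.eval_finsetSum, bernsteinPolynomial, binomialWeight] using this

lemma binomialProb_chebyshev (n : ℕ) {p r : ℝ} (h0 : 0 ≤ p) (h1 : p ≤ 1) (hr : 0 < r) :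
    binomialProb n p {k | r ≤ |n * p - k|} ≤ n / r ^ 2 := by
  classical
  rw [le_div_iff₀ (by positivity)]
  have hv : binomialProb n p {k | r ≤ |n * p - k|} * r ^ 2 ≤ n * p * (1 - p) := by
    rw [← binomialWeight_variance, binomialProb, Finset.sum_mul]
    refine Finset.sum_le_sum fun k _ => ?_
    have hw := binomialWeight_nonneg h0 h1 n k
    simp only [Set.indicator_apply, Set.mem_ofPred_eq]
    split_ifs with h
    · rw [mul_comm, ← sq_abs (_ - _)]
      gcongr
    · rw [zero_mul]; positivity
  refine hv.trans ?_
  have : p * (1 - p) ≤ 1 := by nlinarith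
  have hn : (0 : ℝ) ≤ n := n.cast_nonneg
  nlinarith


/-! ### Second-order behaviour of the log moment generating function -/

/-- The logarithm of the moment generating function of a centred Bernoulli variable. -/
noncomputable def logMgf (p l : ℝ) : ℝ := Real.log (p * Real.exp l + (1 - p)) - l * p

lemma mgf_pos {p : ℝ} (h0 : 0 < p) (h1 : p < 1) (l : ℝ) : 0 < p * Real.exp l + (1 - p) := by
  have : 0 < p * Real.exp l := by positivity
  linarith

lemma mgf_pow_mul_exp {p : ℝ} (h0 : 0 < p) (h1 : p < 1) (l c : ℝ) (n : ℕ) :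
    (p * Real.exp l + (1 - p)) ^ n * Real.exp (-(l * (n * p + c))) =
      Real.exp (n * logMgf p l - l * c) := by
  nth_rewrite 1 [← Real.exp_log (mgf_pos h0 h1 l)]
  rw [← Real.exp_nat_mul, ← Real.exp_add, logMgf]
  ring_nf

lemma tendsto_tilted_mean {p : ℝ} (h0 : 0 < p) (h1 : p < 1) :
    Tendsto (fun l => (p * Real.exp l / (p * Real.exp l + (1 - p)) - p) / l) (𝓝[≠] 0)
      (𝓝 (p * (1 - p))) := by
  have h2 : Tendsto (fun l : ℝ => l⁻¹ • (Real.exp (0 + l) - Real.exp 0)) (𝓝[≠] 0) (𝓝 (Real.exp 0)) :=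
    hasDerivAt_iff_tendsto_slope_zero.1 (Real.hasDerivAt_exp 0)
  have h3 : Tendsto (fun l : ℝ => p * (1 - p) / (p * Real.exp l + (1 - p))) (𝓝[≠] 0)
      (𝓝 (p * (1 - p) / (p * Real.exp 0 + (1 - p)))) := by
    refine ((ContinuousAt.tendsto ?_)).mono_left nhdsWithin_le_nhds
    have := (mgf_pos h0 h1 0).ne'
    fun_prop (disch := assumption)
  have h4 := h3.mul h2
  simp only [Real.exp_zero, mul_one, add_sub_cancel, div_one] at h4
  refine h4.congr fun l => ?_
  have := (mgf_pos h0 h1 l).ne'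
  rw [zero_add, smul_eq_mul, div_eq_mul_inv _ l, mul_comm _ (l⁻¹), mul_left_comm]
  congr 1
  field_simp
  ring

/-- The derivative of `logMgf p` is the tilted mean minus `p`, so l'Hôpital's rule reduces this to
`tendsto_tilted_mean`. -/
lemma tendsto_logMgf_div_sq {p : ℝ} (h0 : 0 < p) (h1 : p < 1) :
    Tendsto (fun l => logMgf p l / l ^ 2) (𝓝[≠] 0) (𝓝 (p * (1 - p) / 2)) := by
  have hd : ∀ l, HasDerivAt (logMgf p) (p * Real.exp l / (p * Real.exp l + (1 - p)) - p) l := by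
    intro l
    have := ((((Real.hasDerivAt_exp l).const_mul p).add_const (1 - p)).log (mgf_pos h0 h1 l).ne').sub
      ((hasDerivAt_id l).mul_const p)
    rw [one_mul] at this
    exact this
  refine HasDerivAt.lhopital_zero_nhdsNE (f' := fun l => p * Real.exp l / (p * Real.exp l + (1 - p)) - p)
    (g' := fun l => 2 * l) (Eventually.of_forall hd) ?_ ?_ ?_ ?_ ?_
  · exact Eventually.of_forall fun l => by simpa using hasDerivAt_pow 2 l
  · filter_upwards [self_mem_nhdsWithin] with l hl
    simpa using hl
  · have := (hd 0).continuousAt.tendsto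
    rw [show logMgf p 0 = 0 by simp [logMgf]] at this
    exact this.mono_left nhdsWithin_le_nhds
  · have : Tendsto (fun l : ℝ => l ^ 2) (𝓝 0) (𝓝 (0 ^ 2)) := (continuous_pow 2).tendsto 0
    rw [zero_pow two_ne_zero] at this
    exact this.mono_left nhdsWithin_le_nhds
  · refine ((tendsto_tilted_mean h0 h1).div_const 2).congr fun l => ?_
    rw [div_div, mul_comm l 2]

/-! ### Moderate deviations of binomial tails -/

/-- The scale of the deviations: `η n → 0` while `n * η n ^ 2 → ∞`. -/
structure IsModerate (η : ℕ → ℝ) : Prop where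
  pos : ∀ᶠ n in atTop, 0 < η n
  zero : Tendsto η atTop (𝓝 0)
  top : Tendsto (fun n : ℕ => (n : ℝ) * η n ^ 2) atTop atTop

variable {η : ℕ → ℝ}

lemma IsModerate.tendsto_const_mul (h : IsModerate η) {k : ℝ} (hk : 0 < k) :
    Tendsto (fun n => k * η n) atTop (𝓝[≠] 0) := by
  refine tendsto_nhdsWithin_iff.2 ⟨by simpa using h.zero.const_mul k, ?_⟩
  filter_upwards [h.pos] with n hn
  simp only [Set.mem_compl_iff, Set.mem_singleton_iff]
  positivity

lemma IsModerate.tendsto_rate (h : IsModerate η) {p : ℝ} (h0 : 0 < p) (h1 : p < 1) {k : ℝ}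
    (hk : 0 < k) (c : ℝ) :
    Tendsto (fun n => k ^ 2 * (logMgf p (k * η n) / (k * η n) ^ 2) - k * c) atTop
      (𝓝 (k ^ 2 * (p * (1 - p) / 2) - k * c)) :=
  (((tendsto_logMgf_div_sq h0 h1).comp (h.tendsto_const_mul hk)).const_mul _).sub_const _

lemma logMgf_scale {p k e : ℝ} (hk : 0 < k) (he : 0 < e) (c : ℝ) (n : ℕ) :
    n * logMgf p (k * e) - k * e * (c * (n * e)) =
      (k ^ 2 * (logMgf p (k * e) / (k * e) ^ 2) - k * c) * (n * e ^ 2) := by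
  field_simp

/-- Moderate deviations upper bound for the upper tail of the binomial distribution. -/
lemma IsModerate.upper_tail_le (h : IsModerate η) {p : ℝ} (h0 : 0 < p) (h1 : p < 1) {c A : ℝ}
    (hc : 0 < c) (hA : A < c ^ 2 / (2 * (p * (1 - p)))) :
    ∀ᶠ n : ℕ in atTop, binomialProb n p {k | n * p + c * (n * η n) ≤ k} ≤
      Real.exp (-(A * (n * η n ^ 2))) := by
  have hv : 0 < p * (1 - p) := mul_pos h0 (by linarith)
  -- The minimiser of the limiting exponent k²p(1-p)/2 - kc.
  set k := c / (p * (1 - p)) with hkd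
  have hk : 0 < k := by positivity
  have e : k ^ 2 * (p * (1 - p) / 2) - k * c = -(c ^ 2 / (2 * (p * (1 - p)))) := by
    rw [hkd]; field_simp; ring
  have h2 := (h.tendsto_rate h0 h1 hk c).eventually_lt_const (u := -A) (by rw [e]; linarith)
  filter_upwards [h2, h.pos] with n hn hp
  refine (binomialProb_chernoff n h0 h1 (l := k * η n) (by positivity) _).trans ?_
  rw [mgf_pow_mul_exp h0 h1, Real.exp_le_exp, logMgf_scale hk hp, ← neg_mul]
  gcongr

/-- Moderate deviations lower bound for the upper tail of the binomial distribution. -/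
lemma IsModerate.le_upper_tail (h : IsModerate η) {p : ℝ} (h0 : 0 < p) (h1 : p < 1) {c A : ℝ}
    (hc : 0 < c) (hA : c ^ 2 / (2 * (p * (1 - p))) < A) :
    ∀ᶠ n : ℕ in atTop, Real.exp (-(A * (n * η n ^ 2))) ≤
      binomialProb n p {k | n * p + c * (n * η n) < k} := by
  have hv : 0 < p * (1 - p) := mul_pos h0 (by linarith)
  -- The window for the tilted law is (c, c + 2d] at scale nη, and the tilt moves the mean to its
  -- centre c + d. As d → 0 the exponent tends to -c²/(2p(1-p)).
  obtain ⟨d, hd, hdA⟩ : ∃ d, 0 < d ∧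
      -A < ((c + d) / (p * (1 - p))) ^ 2 * (p * (1 - p) / 2) -
        ((c + d) / (p * (1 - p))) * (c + 2 * d) := by
    have hcont : Tendsto (fun d : ℝ => ((c + d) / (p * (1 - p))) ^ 2 * (p * (1 - p) / 2) -
        ((c + d) / (p * (1 - p))) * (c + 2 * d)) (𝓝[>] 0)
        (𝓝 (((c + 0) / (p * (1 - p))) ^ 2 * (p * (1 - p) / 2) -
        ((c + 0) / (p * (1 - p))) * (c + 2 * 0))) := by
      refine (Continuous.tendsto ?_ 0).mono_left nhdsWithin_le_nhds
      fun_prop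
    have e : ((c + 0) / (p * (1 - p))) ^ 2 * (p * (1 - p) / 2) -
        ((c + 0) / (p * (1 - p))) * (c + 2 * 0) = -(c ^ 2 / (2 * (p * (1 - p)))) := by
      field_simp; ring
    have := (hcont.eventually_const_lt (u := -A) (by rw [e]; linarith)).and self_mem_nhdsWithin
    obtain ⟨d, hd1, hd2⟩ := this.exists
    exact ⟨d, hd2, hd1⟩
  set k := (c + d) / (p * (1 - p)) with hkd
  have hk : 0 < k := by positivity
  obtain ⟨B, hB, hBA⟩ := exists_between hdA
  have h2 := (h.tendsto_rate h0 h1 hk (c + 2 * d)).eventually_const_lt hBA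
  have h3 : Tendsto (fun n => (p * Real.exp (k * η n) / (p * Real.exp (k * η n) + (1 - p)) - p) /
      (k * η n)) atTop (𝓝 (p * (1 - p))) :=
    (tendsto_tilted_mean h0 h1).comp (h.tendsto_const_mul hk)
  have h4 := (h3.const_mul k).sub_const (c + d)
  rw [show k * (p * (1 - p)) - (c + d) = 0 by rw [hkd, div_mul_cancel₀ _ hv.ne', sub_self]] at h4
  have h5 := h4.abs.eventually_lt_const (u := d / 2) (by rw [abs_zero]; exact half_pos hd)
  -- Chebyshev at radius (d/2)nη leaves mass at most 4/(d²nη²), hence at most 1/2; the next bound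
  -- absorbs the remaining factor 1/2 into the exponent.
  have h6 : ∀ᶠ n : ℕ in atTop, 8 / d ^ 2 ≤ (n : ℝ) * η n ^ 2 := h.top.eventually_ge_atTop _
  have h7 : ∀ᶠ n : ℕ in atTop, Real.log 2 / (A + B) ≤ (n : ℝ) * η n ^ 2 :=
    h.top.eventually_ge_atTop _
  filter_upwards [h2, h.pos, h5, h6, h7, eventually_gt_atTop 0] with n hn hp h5 h6 h7 hn0
  have hn0' : (0 : ℝ) < n := by exact_mod_cast hn0
  refine le_trans ?_ (binomialProb_tilt_lower n h0 h1 (l := k * η n) (by positivity) _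
    (n * p + (c + 2 * d) * (n * η n)))
  rw [mgf_pow_mul_exp h0 h1, logMgf_scale hk hp]
  obtain ⟨hq0, hq1⟩ := tiltedParam_mem (l := k * η n) h0 h1
  set q := p * Real.exp (k * η n) / (p * Real.exp (k * η n) + (1 - p))
  have hhalf : 1 / 2 ≤ binomialProb n q
      {j | n * p + c * (n * η n) < j ∧ j ≤ n * p + (c + 2 * d) * (n * η n)} := by
    have hr : 0 < d / 2 * (n * η n) := by positivity
    have hcheb := binomialProb_chebyshev n hq0 hq1 hr
    have hb : (n : ℝ) / (d / 2 * (n * η n)) ^ 2 ≤ 1 / 2 := by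
      rw [div_le_iff₀ (by positivity)] at h6 ⊢
      nlinarith
    have hcompl := binomialProb_compl n q {j | d / 2 * (n * η n) ≤ |n * q - j|}
    refine le_trans (by linarith) (binomialProb_mono hq0 hq1 n
      (A := {j | d / 2 * (n * η n) ≤ |n * q - j|}ᶜ) fun j hj => ?_)
    simp only [Set.mem_compl_iff, Set.mem_ofPred_eq, not_le] at hj ⊢
    have hq : |n * (q - p) - (c + d) * (n * η n)| < d / 2 * (n * η n) := by
      have e : n * (q - p) - (c + d) * (n * η n) =
          (k * ((q - p) / (k * η n)) - (c + d)) * (n * η n) := by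
        field_simp
      rw [e, abs_mul, abs_of_pos (a := n * η n) (by positivity)]
      gcongr
    rw [abs_lt] at hj hq
    constructor <;> nlinarith
  have hexp : Real.exp (-(A * (n * η n ^ 2))) ≤ Real.exp (B * (n * η n ^ 2)) * (1 / 2) := by
    rw [div_le_iff₀ (by linarith)] at h7
    rw [show (1 / 2 : ℝ) = Real.exp (-Real.log 2) by rw [Real.exp_neg, Real.exp_log two_pos]; norm_num,
      ← Real.exp_add, Real.exp_le_exp]
    linarith
  refine hexp.trans ?_
  gcongr

/-- Reflection turns the lower tail of the binomial distribution into an upper tail. -/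
lemma binomialProb_lower_tail (n : ℕ) (p x : ℝ) :
    binomialProb n p {k | k ≤ n * p - x} = binomialProb n (1 - p) {k | n * (1 - p) + x ≤ k} := by
  rw [binomialProb_reflect]
  refine binomialProb_congr fun k hk => ?_
  simp only [Set.mem_ofPred_eq, Nat.cast_sub hk]
  constructor <;> intro h <;> linarith

lemma binomialProb_lower_tail_strict (n : ℕ) (p x : ℝ) :
    binomialProb n p {k | k < n * p - x} = binomialProb n (1 - p) {k | n * (1 - p) + x < k} := by
  rw [binomialProb_reflect]
  refine binomialProb_congr fun k hk => ?_
  simp only [Set.mem_ofPred_eq, Nat.cast_sub hk]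
  constructor <;> intro h <;> linarith

lemma IsModerate.lower_tail_le (h : IsModerate η) {p : ℝ} (h0 : 0 < p) (h1 : p < 1) {c A : ℝ}
    (hc : 0 < c) (hA : A < c ^ 2 / (2 * (p * (1 - p)))) :
    ∀ᶠ n : ℕ in atTop, binomialProb n p {k | k ≤ n * p - c * (n * η n)} ≤
      Real.exp (-(A * (n * η n ^ 2))) := by
  simp_rw [binomialProb_lower_tail]
  exact h.upper_tail_le (by linarith) (by linarith) hc (by rwa [sub_sub_cancel, mul_comm (1 - p)])

lemma IsModerate.le_lower_tail (h : IsModerate η) {p : ℝ} (h0 : 0 < p) (h1 : p < 1) {c A : ℝ}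
    (hc : 0 < c) (hA : c ^ 2 / (2 * (p * (1 - p))) < A) :
    ∀ᶠ n : ℕ in atTop, Real.exp (-(A * (n * η n ^ 2))) ≤
      binomialProb n p {k | k < n * p - c * (n * η n)} := by
  simp_rw [binomialProb_lower_tail_strict]
  exact h.le_upper_tail (by linarith) (by linarith) hc (by rwa [sub_sub_cancel, mul_comm (1 - p)])

/-- Tails at linear scale are smaller than `exp (-A n η ^ 2)` for every `A`. -/
lemma IsModerate.linear_upper_tail_le (h : IsModerate η) {p x : ℝ} (h0 : 0 < p) (h1 : p < 1)
    (hx : p < x) (A : ℝ) :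
    ∀ᶠ n : ℕ in atTop, binomialProb n p {k | n * x ≤ k} ≤ Real.exp (-(A * (n * η n ^ 2))) := by
  have hv : 0 < p * (1 - p) := mul_pos h0 (by linarith)
  -- Since η → 0, a linear deviation eventually exceeds c·nη for every c, so c may be taken as large
  -- as `A` requires.
  obtain ⟨c, hc, hA⟩ : ∃ c : ℝ, 0 < c ∧ A < c ^ 2 / (2 * (p * (1 - p))) := by
    have : Tendsto (fun c : ℝ => c ^ 2 / (2 * (p * (1 - p)))) atTop atTop :=
      (tendsto_pow_atTop two_ne_zero).atTop_div_const (by positivity)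
    exact ((eventually_gt_atTop 0).and (this.eventually_gt_atTop A)).exists
  have h2 : Tendsto (fun n => c * η n) atTop (𝓝 0) := by simpa using h.zero.const_mul c
  filter_upwards [h.upper_tail_le h0 h1 hc hA, h2.eventually_lt_const (sub_pos.2 hx)]
    with n hn hs
  refine le_trans (binomialProb_mono h0.le h1.le n fun k hk => ?_) hn
  simp only [Set.mem_ofPred_eq] at hk ⊢
  have : (0 : ℝ) ≤ n := n.cast_nonneg
  nlinarith

lemma IsModerate.linear_lower_tail_le (h : IsModerate η) {p x : ℝ} (h0 : 0 < p) (h1 : p < 1)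
    (hx : x < p) (A : ℝ) :
    ∀ᶠ n : ℕ in atTop, binomialProb n p {k | k ≤ n * x} ≤ Real.exp (-(A * (n * η n ^ 2))) := by
  filter_upwards [h.linear_upper_tail_le (p := 1 - p) (x := 1 - x) (by linarith) (by linarith)
    (by linarith) A] with n hn
  have := binomialProb_lower_tail n p (n * (p - x))
  rw [show n * p - n * (p - x) = n * x by ring,
    show n * (1 - p) + n * (p - x) = n * (1 - x) by ring] at this
  rwa [this]


/-! ### The law of the weight of a Bernoulli string -/

/-- The weight (number of ones) of a binary string. -/
def weight {n : ℕ} (x : Fin n → Fin 2) : ℕ := ∑ i, (x i : ℕ)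

lemma weight_comp {n : ℕ} (x : Fin n → Fin 2) (σ : Equiv.Perm (Fin n)) :
    weight (x ∘ σ) = weight x :=
  Equiv.sum_comp σ fun i => (x i : ℕ)

lemma weight_eq_card {n : ℕ} (x : Fin n → Fin 2) :
    weight x = (Finset.univ.filter fun i => x i = 1).card := by
  rw [weight, Finset.card_filter]
  refine Finset.sum_congr rfl fun i _ => ?_
  generalize x i = j
  fin_cases j <;> simp

instance (p : unitInterval) : IsProbabilityMeasure (bern p) := by
  unfold bern; infer_instance

lemma bern_real_singleton (p : unitInterval) (j : Fin 2) :
    (bern p).real {j} = (p : ℝ) ^ (j : ℕ) * (1 - p) ^ (1 - (j : ℕ)) := by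
  unfold bern
  fin_cases j <;> simp

/-- The law of `n` independent Bernoulli variables. -/
noncomputable abbrev bernPi (p : unitInterval) (n : ℕ) : Measure (Fin n → Fin 2) :=
  Measure.pi fun _ : Fin n => bern p

lemma bernPi_real_singleton (p : unitInterval) {n : ℕ} (x : Fin n → Fin 2) :
    (bernPi p n).real {x} = (p : ℝ) ^ weight x * (1 - p) ^ (n - weight x) := by
  have h : n - weight x = ∑ i, (1 - (x i : ℕ)) := by
    have : ∑ i, (1 - (x i : ℕ)) + weight x = n := by
      rw [weight, ← Finset.sum_add_distrib]
      rw [Finset.sum_congr rfl (fun i _ => Nat.sub_add_cancel (by omega : (x i : ℕ) ≤ 1))]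
      simp
    omega
  rw [h, weight, ← Finset.prod_pow_eq_pow_sum, ← Finset.prod_pow_eq_pow_sum,
    ← Finset.prod_mul_distrib, measureReal_def, Measure.pi_singleton, ENNReal.toReal_prod]
  exact Finset.prod_congr rfl fun i _ => bern_real_singleton p (x i)

lemma bernPi_real_weight (p : unitInterval) (n : ℕ) (A : Set ℕ) :
    (bernPi p n).real (weight ⁻¹' A) = binomialProb n p A := by
  classical
  have h1 : (bernPi p n).real (weight ⁻¹' A) =
      ∑ x : Fin n → Fin 2, A.indicator (fun k => (p : ℝ) ^ k * (1 - p) ^ (n - k)) (weight x) := by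
    have e : (weight ⁻¹' A : Set (Fin n → Fin 2)) =
        ((Finset.univ.filter fun x => weight x ∈ A : Finset (Fin n → Fin 2)) : Set _) := by
      ext x; simp
    rw [e, ← sum_measureReal_singleton, Finset.sum_filter]
    refine Finset.sum_congr rfl fun x _ => ?_
    rw [Set.indicator_apply, bernPi_real_singleton]
  have h2 : ∑ x : Fin n → Fin 2,
        A.indicator (fun k => (p : ℝ) ^ k * (1 - p) ^ (n - k)) (weight x) =
      ∑ S ∈ (Finset.univ : Finset (Fin n)).powerset,
        A.indicator (fun k => (p : ℝ) ^ k * (1 - p) ^ (n - k)) S.card := by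
    refine Finset.sum_bij' (fun x _ => Finset.univ.filter fun i => x i = 1)
      (fun S _ => fun i => if i ∈ S then 1 else 0) ?_ ?_ ?_ ?_ ?_
    · simp
    · simp
    · intro x _
      funext i
      have := Fin.exists_fin_two.1 ⟨x i, rfl⟩
      rcases this with h | h <;> simp [h]
    · intro S _
      ext i
      simp
    · intro x _
      rw [weight_eq_card]
  rw [h1, h2, Finset.sum_powerset_apply_card]
  simp only [Finset.card_univ, Fintype.card_fin, nsmul_eq_mul]
  refine Finset.sum_congr rfl fun k _ => ?_
  simp only [Set.indicator_apply, binomialWeight]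
  split_ifs <;> ring

/-! ### Exchangeable measures on binary strings -/

lemma exists_perm_of_weight_eq {n : ℕ} {x y : Fin n → Fin 2} (h : weight x = weight y) :
    ∃ σ : Equiv.Perm (Fin n), y ∘ σ = x := by
  classical
  rw [weight_eq_card, weight_eq_card] at h
  have e : {i // x i = 1} ≃ {i // y i = 1} := Fintype.equivOfCardEq (by
    rwa [Fintype.card_subtype, Fintype.card_subtype])
  refine ⟨e.extendSubtype, funext fun i => ?_⟩
  by_cases hi : x i = 1
  · exact (e.extendSubtype_mem i hi).trans hi.symm
  · have h1 := e.extendSubtype_not_mem i hi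
    simp only [Function.comp_apply]
    omega

/-- Permutations act transitively on strings of equal weight, so an exchangeable measure is uniform
on each weight class and is determined by the masses of the classes. -/
lemma eq_of_exchangeable {n : ℕ} {μ ν : Measure (Fin n → Fin 2)}
    (hμ : ∀ x (σ : Equiv.Perm (Fin n)), μ {x ∘ σ} = μ {x})
    (hν : ∀ x (σ : Equiv.Perm (Fin n)), ν {x ∘ σ} = ν {x})
    (h : μ.map weight = ν.map weight) : μ = ν := by
  classical
  refine Measure.ext_of_singleton fun x => ?_
  have key : ∀ ρ : Measure (Fin n → Fin 2), (∀ y (σ : Equiv.Perm (Fin n)), ρ {y ∘ σ} = ρ {y}) →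
      ρ.map weight {weight x} =
        ((Finset.univ.filter fun y : Fin n → Fin 2 => weight y = weight x).card : ℝ≥0∞) * ρ {x} := by
    intro ρ hρ
    have e : (weight ⁻¹' {weight x} : Set (Fin n → Fin 2)) =
        ((Finset.univ.filter fun y => weight y = weight x : Finset (Fin n → Fin 2)) : Set _) := by
      ext y; simp
    rw [Measure.map_apply .of_discrete .of_discrete, e, ← sum_measure_singleton,
      ← nsmul_eq_mul, ← Finset.sum_const]
    refine Finset.sum_congr rfl fun y hy => ?_
    obtain ⟨σ, hσ⟩ := exists_perm_of_weight_eq (Finset.mem_filter.1 hy).2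
    rw [← hσ, hρ]
  have h1 := key μ hμ
  rw [h, key ν hν] at h1
  refine ((ENNReal.mul_right_inj ?_ (ENNReal.natCast_ne_top _)).1 h1).symm
  rw [Nat.cast_ne_zero, ← Nat.pos_iff_ne_zero, Finset.card_pos]
  exact ⟨x, by simp⟩

lemma bernPi_exchangeable (p : unitInterval) {n : ℕ} (x : Fin n → Fin 2)
    (σ : Equiv.Perm (Fin n)) : bernPi p n {x ∘ σ} = bernPi p n {x} := by
  rw [Measure.pi_singleton, Measure.pi_singleton]
  exact Equiv.prod_comp σ fun i => bern p {x i}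

/-! ### Couplings of Bernoulli strings from couplings of their weights -/

/-- The string `1 ... 1 0 ... 0` with `k` ones. -/
def onesThenZeros (n k : ℕ) : Fin n → Fin 2 := fun i => if (i : ℕ) < k then 1 else 0

lemma weight_onesThenZeros {n k : ℕ} (h : k ≤ n) : weight (onesThenZeros n k) = k := by
  rw [weight_eq_card]
  have : (Finset.univ.filter fun i : Fin n => onesThenZeros n k i = 1) =
      Finset.univ.filter fun i : Fin n => (i : ℕ) < k := by
    ext i
    simp [onesThenZeros]
  rw [this, Fin.card_filter_val_lt, min_eq_right h]

lemma abs_weight_sub_le {n : ℕ} (x y : Fin n → Fin 2) :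
    |(weight x : ℝ) - weight y| ≤ ∑ i, hammingCost (x i) (y i) := by
  simp only [weight, Nat.cast_sum]
  rw [← Finset.sum_sub_distrib]
  refine (Finset.abs_sum_le_sum_abs _ _).trans (Finset.sum_le_sum fun i _ => ?_)
  generalize x i = j
  generalize y i = k
  fin_cases j <;> fin_cases k <;> simp [hammingCost]

lemma hammingCost_comm (x y : Fin 2) : hammingCost x y = hammingCost y x := by
  simp [hammingCost, eq_comm]

lemma sum_hammingCost_onesThenZeros {n k l : ℕ} (hk : k ≤ n) (hl : l ≤ n) :
    ∑ i, hammingCost (onesThenZeros n k i) (onesThenZeros n l i) = |(k : ℝ) - l| := by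
  wlog h : k ≤ l generalizing k l
  · rw [abs_sub_comm, ← this hl hk (not_le.1 h).le]
    exact Finset.sum_congr rfl fun i _ => hammingCost_comm _ _
  have e : ∀ i, hammingCost (onesThenZeros n k i) (onesThenZeros n l i) =
      ((onesThenZeros n l i : ℕ) : ℝ) - ((onesThenZeros n k i : ℕ) : ℝ) := by
    intro i
    unfold hammingCost onesThenZeros
    split_ifs <;> first | omega | simp_all
  rw [abs_sub_comm, abs_of_nonneg (by simpa using h)]
  simp only [e, Finset.sum_sub_distrib, ← Nat.cast_sum]
  rw [← weight, ← weight, weight_onesThenZeros hk, weight_onesThenZeros hl]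

lemma lt_avgCost_iff {n : ℕ} (hn : 0 < n) (t : ℝ) (x y : Fin n → Fin 2) :
    t < avgCost hammingCost n x y ↔ n * t < ∑ i, hammingCost (x i) (y i) := by
  have : (0 : ℝ) < n := by exact_mod_cast hn
  rw [avgCost, one_div, inv_mul_eq_div, lt_div_iff₀' this]

section Symmetrize

variable {Ω : Type*} [MeasurableSpace Ω] {μ : Measure Ω} {n : ℕ}

/-- The law of `X` after applying a uniformly random permutation of the coordinates. -/
noncomputable def symmetrize {E : Type*} [MeasurableSpace E] (μ : Measure Ω)
    (X : Equiv.Perm (Fin n) → Ω → E) : Measure E :=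
  ∑ σ : Equiv.Perm (Fin n), ((Nat.factorial n : ℝ≥0∞)⁻¹) • μ.map (X σ)

lemma map_symmetrize {E F : Type*} [MeasurableSpace E] [MeasurableSpace F]
    {X : Equiv.Perm (Fin n) → Ω → E} (hX : ∀ σ, Measurable (X σ)) {φ : E → F} (hφ : Measurable φ) :
    (symmetrize μ X).map φ = symmetrize μ fun σ ω => φ (X σ ω) := by
  unfold symmetrize
  rw [Measure.map_finset_sum hφ.aemeasurable]
  refine Finset.sum_congr rfl fun σ _ => ?_
  rw [Measure.map_smul, Measure.map_map hφ (hX σ)]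
  rfl

lemma symmetrize_const {E : Type*} [MeasurableSpace E] (X : Ω → E) :
    symmetrize μ (fun _ : Equiv.Perm (Fin n) => X) = μ.map X := by
  unfold symmetrize
  rw [Finset.sum_const, Finset.card_univ, Fintype.card_perm, Fintype.card_fin,
    ← Nat.cast_smul_eq_nsmul ℝ≥0∞, smul_smul, ENNReal.mul_inv_cancel (by simp [Nat.factorial_ne_zero]) (ENNReal.natCast_ne_top _),
    one_smul]

lemma symmetrize_eq_bernPi {f : Ω → ℕ} (hf : Measurable f) (hfn : ∀ ω, f ω ≤ n) {p : unitInterval}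
    (h : μ.map f = (bernPi p n).map weight) :
    symmetrize μ (fun (σ : Equiv.Perm (Fin n)) ω => onesThenZeros n (f ω) ∘ σ) = bernPi p n := by
  have hm : ∀ σ : Equiv.Perm (Fin n), Measurable fun ω => onesThenZeros n (f ω) ∘ σ := fun σ =>
    (Measurable.of_discrete (f := fun k => onesThenZeros n k ∘ σ)).comp hf
  refine eq_of_exchangeable (fun x τ => ?_) (bernPi_exchangeable p) ?_
  · unfold symmetrize
    simp only [Measure.finsetSum_apply, Measure.smul_apply]
    -- Reindexing σ ↦ στ turns the event for x ∘ τ into the event for x.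
    refine (Equiv.sum_comp (Equiv.mulRight τ) _).symm.trans (Finset.sum_congr rfl fun σ _ => ?_)
    rw [Measure.map_apply (hm _) .of_discrete, Measure.map_apply (hm _) .of_discrete]
    congr 2
    ext ω
    simp only [Set.mem_preimage, Set.mem_singleton_iff, Equiv.coe_mulRight, Equiv.Perm.coe_mul]
    rw [← Function.comp_assoc]
    exact τ.surjective.injective_comp_right.eq_iff
  · rw [map_symmetrize hm .of_discrete, ← h]
    simp only [weight_comp, weight_onesThenZeros (hfn _)]
    exact symmetrize_const f

variable [IsFiniteMeasure μ]

/-- A coupling of the weights gives a coupling of the strings whose Hamming cost is the difference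
of the weights. -/
lemma binaryECP_le (hn : 0 < n) {f g : Ω → ℕ} (hf : Measurable f) (hg : Measurable g)
    (hfn : ∀ ω, f ω ≤ n) (hgn : ∀ ω, g ω ≤ n) {a b : unitInterval}
    (hfa : μ.map f = (bernPi a n).map weight) (hgb : μ.map g = (bernPi b n).map weight) (t : ℝ) :
    binaryECP a b n t ≤ μ.real {ω | n * t < |(f ω : ℝ) - g ω|} := by
  have hX : ∀ σ : Equiv.Perm (Fin n), Measurable fun ω =>
      (onesThenZeros n (f ω) ∘ σ, onesThenZeros n (g ω) ∘ σ) := fun σ =>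
    ((Measurable.of_discrete (f := fun k => onesThenZeros n k ∘ σ)).comp hf).prodMk
      ((Measurable.of_discrete (f := fun k => onesThenZeros n k ∘ σ)).comp hg)
  set π := symmetrize μ fun (σ : Equiv.Perm (Fin n)) ω =>
      (onesThenZeros n (f ω) ∘ σ, onesThenZeros n (g ω) ∘ σ) with hπ
  have hmem : π ∈ couplings (bernPi a n) (bernPi b n) := by
    constructor
    · rw [hπ, map_symmetrize hX measurable_fst]
      exact symmetrize_eq_bernPi hf hfn hfa
    · rw [hπ, map_symmetrize hX measurable_snd]
      exact symmetrize_eq_bernPi hg hgn hgb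
  have hS : MeasurableSet {ω | n * t < |(f ω : ℝ) - g ω|} :=
    (hf.prodMk hg) (MeasurableSet.of_discrete (s := {q : ℕ × ℕ | n * t < |(q.1 : ℝ) - q.2|}))
  have hval : π {p | t < avgCost hammingCost n p.1 p.2} = μ {ω | n * t < |(f ω : ℝ) - g ω|} := by
    have e : ∀ σ : Equiv.Perm (Fin n),
        μ.map (fun ω => (onesThenZeros n (f ω) ∘ σ, onesThenZeros n (g ω) ∘ σ))
          {p | t < avgCost hammingCost n p.1 p.2} = μ {ω | n * t < |(f ω : ℝ) - g ω|} := by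
      intro σ
      rw [Measure.map_apply (hX σ) .of_discrete]
      congr 1
      ext ω
      simp only [Set.mem_preimage, Set.mem_ofPred_eq, lt_avgCost_iff hn, Function.comp_apply]
      rw [Equiv.sum_comp σ fun i => hammingCost (onesThenZeros n (f ω) i) (onesThenZeros n (g ω) i),
        sum_hammingCost_onesThenZeros (hfn ω) (hgn ω)]
    rw [hπ]
    unfold symmetrize
    simp only [Measure.finsetSum_apply, Measure.smul_apply, e]
    rw [Finset.sum_const, Finset.card_univ, Fintype.card_perm, Fintype.card_fin, nsmul_eq_mul, smul_eq_mul,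
      ← mul_assoc, ENNReal.mul_inv_cancel (by simp [Nat.factorial_ne_zero])
        (ENNReal.natCast_ne_top _), one_mul]
  unfold binaryECP excessCostProb
  refine ENNReal.toReal_mono (measure_ne_top _ _) ?_
  rw [← hval]
  exact iInf₂_le π hmem

end Symmetrize

/-- Any coupling exceeds the cost `t` when the weights are further apart than `n * t`. -/
lemma le_binaryECP {a b : unitInterval} {n : ℕ} (hn : 0 < n) {t r : ℝ}
    (h : ∀ π : Measure ((Fin n → Fin 2) × (Fin n → Fin 2)), IsProbabilityMeasure π →
      (∀ A, π.real {q | weight q.1 ∈ A} = binomialProb n a A) →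
      (∀ A, π.real {q | weight q.2 ∈ A} = binomialProb n b A) →
      r ≤ π.real {q | n * t < |(weight q.1 : ℝ) - weight q.2|}) :
    r ≤ binaryECP a b n t := by
  unfold binaryECP excessCostProb
  rw [← ENNReal.ofReal_le_iff_le_toReal]
  · refine le_iInf₂ fun π hπ => ?_
    have hp : IsProbabilityMeasure π := by
      constructor
      rw [← Set.preimage_univ (f := Prod.fst), ← Measure.map_apply measurable_fst .univ, hπ.1]
      exact measure_univ
    have hπ1 : π.map Prod.fst = bernPi a n := hπ.1
    have hπ2 : π.map Prod.snd = bernPi b n := hπ.2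
    have h1 := h π hp (fun A => ?_) (fun A => ?_)
    · refine ENNReal.ofReal_le_of_le_toReal (h1.trans ?_)
      refine measureReal_mono fun q hq => ?_
      exact (lt_avgCost_iff hn t _ _).2 (lt_of_lt_of_le hq (abs_weight_sub_le _ _))
    · rw [← bernPi_real_weight, ← hπ1, map_measureReal_apply measurable_fst .of_discrete]
      rfl
    · rw [← bernPi_real_weight, ← hπ2, map_measureReal_apply measurable_snd .of_discrete]
      rfl
  -- The infimum must be finite for `toReal` to be faithful; the product coupling bounds it by 1.
  · refine ne_top_of_le_ne_top ENNReal.one_ne_top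
      ((iInf₂_le ((bernPi a n).prod (bernPi b n)) ?_).trans prob_le_one)
    exact ⟨by simp [Measure.map_fst_prod], by simp [Measure.map_snd_prod]⟩

/-! ### Quantile couplings -/

/-- The quantile function of the binomial distribution. -/
noncomputable def binomialQuantile (n : ℕ) (p : ℝ) (u : ℝ) : ℕ :=
  sInf {k | u ≤ binomialProb n p (Set.Iic k)}

section Quantile

variable {n : ℕ} {p : ℝ}

lemma binomialProb_Iic_self : binomialProb n p (Set.Iic n) = 1 := by
  rw [← binomialProb_univ n p]
  exact binomialProb_congr fun k hk => by simpa using hk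

lemma binomialQuantile_le_iff (h0 : 0 ≤ p) (h1 : p ≤ 1) {u : ℝ} (hu : u ≤ 1) (k : ℕ) :
    binomialQuantile n p u ≤ k ↔ u ≤ binomialProb n p (Set.Iic k) := by
  have hne : {k | u ≤ binomialProb n p (Set.Iic k)}.Nonempty :=
    ⟨n, by simpa [binomialProb_Iic_self] using hu⟩
  constructor
  · intro h
    exact (Nat.sInf_mem hne).trans (binomialProb_mono h0 h1 n (Set.Iic_subset_Iic.2 h))
  · exact fun h => Nat.sInf_le h

lemma binomialQuantile_le (h0 : 0 ≤ p) (h1 : p ≤ 1) {u : ℝ} (hu : u ≤ 1) :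
    binomialQuantile n p u ≤ n := by
  rw [binomialQuantile_le_iff h0 h1 hu, binomialProb_Iic_self]
  exact hu

lemma le_of_binomialQuantile_mem (h0 : 0 ≤ p) (h1 : p ≤ 1) {u : ℝ} (hu : u ≤ 1) {A : Set ℕ}
    (hA : IsLowerSet A) (h : binomialQuantile n p u ∈ A) : u ≤ binomialProb n p A :=
  ((binomialQuantile_le_iff h0 h1 hu _).1 le_rfl).trans
    (binomialProb_mono h0 h1 n fun _ hk => hA hk h)

/-- Positivity of `u` excludes the empty lower set: at u = 0 the quantile is 0, which lies outside
it. -/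
lemma binomialQuantile_mem_of_le (h0 : 0 ≤ p) (h1 : p ≤ 1) {u : ℝ} (hu0 : 0 < u) (hu : u ≤ 1)
    {A : Set ℕ} (hA : IsLowerSet A) (h : u ≤ binomialProb n p A) :
    binomialQuantile n p u ∈ A := by
  by_contra hq
  have hpos : 0 < binomialQuantile n p u := by
    rcases Nat.eq_zero_or_pos (binomialQuantile n p u) with h2 | h2
    · exfalso
      have : A = ∅ := Set.eq_empty_of_forall_notMem fun k hk => hq (hA (h2 ▸ Nat.zero_le k) hk)
      rw [this, binomialProb_empty] at h
      linarith
    · exact h2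
  have h2 : binomialQuantile n p u ≤ binomialQuantile n p u - 1 := by
    rw [binomialQuantile_le_iff h0 h1 hu]
    refine h.trans (binomialProb_mono h0 h1 n fun k hk => ?_)
    have : k < binomialQuantile n p u := by
      by_contra h3
      exact hq (hA (not_lt.1 h3) hk)
    exact Nat.le_sub_one_of_lt this
  omega

end Quantile

section

variable (n : ℕ) (p : unitInterval)

lemma measurable_binomialQuantile : Measurable fun u : unitInterval => binomialQuantile n p u := by
  refine measurable_of_Iic fun k => ?_
  have : (fun u : unitInterval => binomialQuantile n p u) ⁻¹' Set.Iic k =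
      {u : unitInterval | (u : ℝ) ≤ binomialProb n p (Set.Iic k)} := by
    ext u
    exact binomialQuantile_le_iff p.2.1 p.2.2 u.2.2 k
  rw [this]
  exact measurableSet_le measurable_subtype_coe measurable_const

lemma map_binomialQuantile :
    (volume : Measure unitInterval).map (fun u : unitInterval => binomialQuantile n p u) =
      (bernPi p n).map weight := by
  have : IsProbabilityMeasure ((bernPi p n).map weight) :=
    Measure.isProbabilityMeasure_map Measurable.of_discrete.aemeasurable
  have : IsProbabilityMeasure ((volume : Measure unitInterval).map
      (fun u : unitInterval => binomialQuantile n p u)) :=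
    Measure.isProbabilityMeasure_map (measurable_binomialQuantile n p).aemeasurable
  refine Measure.ext_of_Iic _ _ fun k => ?_
  rw [Measure.map_apply (measurable_binomialQuantile n p) measurableSet_Iic,
    Measure.map_apply .of_discrete .of_discrete]
  have hF0 := binomialProb_nonneg p.2.1 p.2.2 n (Set.Iic k)
  have hF1 := binomialProb_le_one p.2.1 p.2.2 n (Set.Iic k)
  have : (fun u : unitInterval => binomialQuantile n p u) ⁻¹' Set.Iic k =
      Set.Iic (⟨binomialProb n p (Set.Iic k), hF0, hF1⟩ : unitInterval) := by
    ext u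
    exact binomialQuantile_le_iff p.2.1 p.2.2 u.2.2 k
  rw [this, unitInterval.volume_Iic]
  change ENNReal.ofReal (binomialProb n p (Set.Iic k)) = _
  rw [← bernPi_real_weight, measureReal_def, ENNReal.ofReal_toReal (measure_ne_top _ _)]

lemma map_binomialQuantile_symm :
    (volume : Measure unitInterval).map
      (fun u : unitInterval => binomialQuantile n p (unitInterval.symm u)) =
      (bernPi p n).map weight := by
  rw [← map_binomialQuantile, ← unitInterval.measurePreserving_symm.map_eq,
    Measure.map_map (measurable_binomialQuantile n p) unitInterval.measurable_symm,
    unitInterval.measurePreserving_symm.map_eq]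
  rfl

lemma volume_real_of_map_eq {f : unitInterval → ℕ} (hf : Measurable f)
    (h : (volume : Measure unitInterval).map f = (bernPi p n).map weight) (A : Set ℕ) :
    (volume : Measure unitInterval).real (f ⁻¹' A) = binomialProb n p A := by
  rw [← bernPi_real_weight, ← map_measureReal_apply hf .of_discrete, h,
    map_measureReal_apply .of_discrete .of_discrete]

end


/-! ### Bounds on the excess-cost probability by binomial tails -/

section Bounds

variable {a b : unitInterval} {n : ℕ} {t : ℝ}

lemma isLowerSet_setOf_cast_lt (x : ℝ) : IsLowerSet {k : ℕ | (k : ℝ) < x} :=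
  fun _ _ h (hk : _ < x) => lt_of_le_of_lt (Nat.cast_le.2 h) hk

lemma isLowerSet_setOf_cast_le (x : ℝ) : IsLowerSet {k : ℕ | (k : ℝ) ≤ x} :=
  fun _ _ h (hk : _ ≤ x) => (Nat.cast_le.2 h).trans hk

lemma tail_sub_tail_le_binaryECP (hn : 0 < n) {x y : ℝ} (h : n * t ≤ y - x) :
    binomialProb n b {k | y < k} - binomialProb n a {k | x ≤ k} ≤ binaryECP a b n t := by
  refine le_binaryECP hn fun π _ h1 h2 => ?_
  rw [← h1, ← h2, sub_le_iff_le_add]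
  refine le_trans (measureReal_mono fun q hq => ?_) (measureReal_union_le _ _)
  simp only [Set.mem_ofPred_eq, Set.mem_union] at hq ⊢
  by_cases hx : x ≤ weight q.1
  · exact Or.inr hx
  · left
    rw [abs_sub_comm]
    refine lt_of_lt_of_le ?_ (le_abs_self _)
    linarith [not_le.1 hx]

/-- The bound from the comonotone coupling of the weights. -/
lemma binaryECP_le_of_comonotone (hn : 0 < n) {ι : Type*} {s : Set ι} {x y : ι → ℝ}
    {m y₀ y₁ : ℝ} (hcell : ∀ i ∈ s, binomialProb n a {k | k < x i} ≤ binomialProb n b {k | k < y i})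
    (hcover : ∀ X Y : ℝ, y₀ < Y → Y < y₁ → n * t < Y - X → ∃ i ∈ s, X < x i ∧ y i ≤ Y) :
    binaryECP a b n t ≤ binomialProb n a {k | m ≤ k} + binomialProb n b {k | k ≤ m} +
      binomialProb n b {k | y₁ ≤ k} + binomialProb n b {k | k ≤ y₀} := by
  set f : unitInterval → ℕ := fun u => binomialQuantile n a u
  set g : unitInterval → ℕ := fun u => binomialQuantile n b u
  have hfm : Measurable f := measurable_binomialQuantile n a
  have hgm : Measurable g := measurable_binomialQuantile n b
  refine (binaryECP_le (μ := volume) hn hfm hgm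
    (fun u => binomialQuantile_le a.2.1 a.2.2 u.2.2)
    (fun u => binomialQuantile_le b.2.1 b.2.2 u.2.2)
    (map_binomialQuantile n a) (map_binomialQuantile n b) t).trans ?_
  have hfv := volume_real_of_map_eq n a hfm (map_binomialQuantile n a)
  have hgv := volume_real_of_map_eq n b hgm (map_binomialQuantile n b)
  rw [← hfv, ← hgv, ← hgv, ← hgv]
  have h0 : (volume : Measure unitInterval).real {0} = 0 := by simp [measureReal_def]
  -- The level `m` serves to remove the absolute value: off the first two sets X < m < Y. If X < x i
  -- and y i ≤ Y, then u ≤ P(X < x i) ≤ P(Y < y i) forces Y < y i, a contradiction.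
  have hsub : {u | n * t < |(f u : ℝ) - g u|} ⊆
      f ⁻¹' {k | m ≤ k} ∪ g ⁻¹' {k | k ≤ m} ∪ g ⁻¹' {k | y₁ ≤ k} ∪ g ⁻¹' {k | k ≤ y₀} ∪ {0} := by
    intro u hu
    by_contra hc
    simp only [Set.mem_union, Set.mem_preimage, Set.mem_ofPred_eq, Set.mem_singleton_iff,
      not_or, not_le] at hc hu
    obtain ⟨⟨⟨⟨h1, h2⟩, h3⟩, h4⟩, h5⟩ := hc
    rw [abs_of_neg (by linarith), neg_sub] at hu
    obtain ⟨i, hi, hx, hy⟩ := hcover _ _ h4 h3 hu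
    have hu0 : 0 < (u : ℝ) := lt_of_le_of_ne u.2.1 fun h => h5 (Subtype.ext h.symm)
    have h6 := le_of_binomialQuantile_mem a.2.1 a.2.2 u.2.2 (isLowerSet_setOf_cast_lt (x i)) hx
    have h7 := binomialQuantile_mem_of_le b.2.1 b.2.2 hu0 u.2.2 (isLowerSet_setOf_cast_lt (y i))
      (h6.trans (hcell i hi))
    exact absurd hy (not_le.2 h7)
  have e1 := measureReal_mono (μ := (volume : Measure unitInterval)) hsub
  refine e1.trans ((measureReal_union_le _ _).trans ?_)
  rw [h0, add_zero]
  exact (measureReal_union_le _ _).trans (add_le_add_left ((measureReal_union_le _ _).trans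
    (add_le_add_left (measureReal_union_le _ _) _)) _)

/-- The bound from the countermonotone coupling of the weights. -/
lemma le_one_sub_binaryECP_of_countermonotone (hn : 0 < n) {x y m : ℝ}
    (hxy : y - x ≤ n * t) :
    min (binomialProb n a {k | x < k}) (binomialProb n b {k | k < y}) -
      (binomialProb n a {k | m ≤ k} + binomialProb n b {k | k ≤ m}) ≤ 1 - binaryECP a b n t := by
  set f : unitInterval → ℕ := fun u => binomialQuantile n a u
  set g : unitInterval → ℕ := fun u => binomialQuantile n b (unitInterval.symm u)
  have hfm : Measurable f := measurable_binomialQuantile n a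
  have hgm : Measurable g := (measurable_binomialQuantile n b).comp unitInterval.measurable_symm
  have hle := binaryECP_le (μ := volume) hn hfm hgm
    (fun u => binomialQuantile_le a.2.1 a.2.2 u.2.2)
    (fun u => binomialQuantile_le b.2.1 b.2.2 (unitInterval.symm u).2.2)
    (map_binomialQuantile n a) (map_binomialQuantile_symm n b) t
  have hfv := volume_real_of_map_eq n a hfm (map_binomialQuantile n a)
  have hgv := volume_real_of_map_eq n b hgm (map_binomialQuantile_symm n b)
  set S : Set unitInterval := {u | n * t < |(f u : ℝ) - g u|} with hS
  have hSm : MeasurableSet S :=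
    (hfm.prodMk hgm) (MeasurableSet.of_discrete (s := {q : ℕ × ℕ | n * t < |(q.1 : ℝ) - q.2|}))
  have hw0 : 0 ≤ min (binomialProb n a {k | x < k}) (binomialProb n b {k | k < y}) :=
    le_min (binomialProb_nonneg a.2.1 a.2.2 _ _) (binomialProb_nonneg b.2.1 b.2.2 _ _)
  have hw1 : min (binomialProb n a {k | x < k}) (binomialProb n b {k | k < y}) ≤ 1 :=
    (min_le_left _ _).trans (binomialProb_le_one a.2.1 a.2.2 _ _)
  set w : unitInterval := ⟨_, hw0, hw1⟩ with hw
  have hwv : (w : ℝ) = min (binomialProb n a {k | x < k}) (binomialProb n b {k | k < y}) := rfl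
  have hJ : (volume : Measure unitInterval).real (Set.Ioo (unitInterval.symm w) 1) = w := by
    rw [measureReal_def, unitInterval.volume_Ioo, unitInterval.coe_symm_eq, Set.Icc.coe_one,
      sub_sub_cancel, ENNReal.toReal_ofReal w.2.1]
  -- For u > 1 - w, the increasing quantile of X exceeds `x` and the reversed quantile of Y is below
  -- `y`. Excluding u = 1 keeps the argument of the reversed quantile positive.
  have hsub : Set.Ioo (unitInterval.symm w) 1 ⊆ Sᶜ ∪ (f ⁻¹' {k | m ≤ k} ∪ g ⁻¹' {k | k ≤ m}) := by
    rintro u ⟨hu0, hu1⟩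
    by_contra hc
    simp only [Set.mem_union, Set.mem_compl_iff, Set.mem_preimage, Set.mem_ofPred_eq,
      not_or, not_le, not_not, hS] at hc
    obtain ⟨h1, h2, h3⟩ := hc
    have hu0' : 1 - (w : ℝ) < u := hu0
    have hu1' : (u : ℝ) < 1 := hu1
    rw [abs_of_neg (by linarith), neg_sub] at h1
    have h4 : x < f u := by
      by_contra h
      have h5 := le_of_binomialQuantile_mem a.2.1 a.2.2 u.2.2 (isLowerSet_setOf_cast_le x)
        (not_lt.1 h)
      have h6 := binomialProb_compl n a {k | (k : ℝ) ≤ x}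
      have h7 : {k : ℕ | (k : ℝ) ≤ x}ᶜ = {k : ℕ | x < k} := by ext; simp
      rw [h7] at h6
      have := min_le_left (binomialProb n a {k | x < k}) (binomialProb n b {k | k < y})
      linarith
    have h5 : (g u : ℝ) < y := by
      refine binomialQuantile_mem_of_le b.2.1 b.2.2 (A := {k | (k : ℝ) < y}) ?_
        (unitInterval.symm u).2.2 (isLowerSet_setOf_cast_lt y) ?_
      · rw [unitInterval.coe_symm_eq]; linarith
      · have := min_le_right (binomialProb n a {k | x < k}) (binomialProb n b {k | k < y})
        rw [unitInterval.coe_symm_eq]; linarith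
    linarith
  have e1 := (measureReal_mono (μ := (volume : Measure unitInterval)) hsub).trans
    ((measureReal_union_le _ _).trans (add_le_add_right (measureReal_union_le _ _) _))
  rw [hJ, hfv, hgv, probReal_compl_eq_one_sub hSm, hwv] at e1
  linarith

end Bounds

/-! ### Exponential rates -/

lemma eventually_const_mul_exp_le {r : ℕ → ℝ} (hr : Tendsto r atTop atTop) {A B : ℝ} (h : A < B)
    (C : ℝ) : ∀ᶠ n in atTop, C * Real.exp (-(B * r n)) ≤ Real.exp (-(A * r n)) := by
  have h1 : Tendsto (fun n => Real.exp ((B - A) * r n)) atTop atTop :=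
    Real.tendsto_exp_atTop.comp (hr.const_mul_atTop (sub_pos.2 h))
  filter_upwards [h1.eventually_ge_atTop C] with n hn
  calc C * Real.exp (-(B * r n)) ≤ Real.exp ((B - A) * r n) * Real.exp (-(B * r n)) := by gcongr
    _ = Real.exp (-(A * r n)) := by rw [← Real.exp_add]; ring_nf

lemma tendsto_neg_mul_log {s r G : ℕ → ℝ} (hs : ∀ᶠ n in atTop, 0 < s n)
    (hr : ∀ᶠ n in atTop, s n * r n = 1) {L : ℝ}
    (hup : ∀ A < L, ∀ᶠ n in atTop, G n ≤ Real.exp (-(A * r n)))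
    (hlo : ∀ A > L, ∀ᶠ n in atTop, Real.exp (-(A * r n)) ≤ G n) :
    Tendsto (fun n => -s n * Real.log (G n)) atTop (𝓝 L) := by
  rw [tendsto_order]
  constructor
  · intro A' hA'
    obtain ⟨A, h1, h2⟩ := exists_between hA'
    -- The lower bound at L + 1 serves only to make `G n` positive, so that the logarithm is
    -- monotone there.
    filter_upwards [hs, hr, hup A h2, hlo (L + 1) (by linarith)] with n hs hr hu hl
    have h3 := Real.log_le_log ((Real.exp_pos _).trans_le hl) hu
    rw [Real.log_exp] at h3
    have h4 := mul_le_mul_of_nonneg_left h3 hs.le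
    linear_combination h4 + h1 - A * hr
  · intro A' hA'
    obtain ⟨A, h1, h2⟩ := exists_between hA'
    filter_upwards [hs, hr, hlo A h1] with n hs hr hl
    have h3 := Real.log_le_log (Real.exp_pos _) hl
    rw [Real.log_exp] at h3
    have h4 := mul_le_mul_of_nonneg_left h3 hs.le
    linear_combination h4 + h2 + A * hr

/-! ### Exponents of the excess-cost probability for each sign of Δ -/

section Rates

variable {η : ℕ → ℝ} {a b : unitInterval} {Δ : ℝ}

/-- Ordering of two tails whose rates are ordered. -/
lemma IsModerate.lower_prob_le (h : IsModerate η) {p q : ℝ} (hp0 : 0 < p) (hp1 : p < 1)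
    (hq0 : 0 < q) (hq1 : q < 1) {R : ℝ} (hR : 1 < R) (hR2 : q * (1 - q) = R ^ 2 * (p * (1 - p)))
    {d e : ℝ} (hde : (d ≤ 0 ∧ e < d) ∨ (0 < d ∧ e * R < d)) :
    ∀ᶠ n : ℕ in atTop, binomialProb n p {k | k < n * p + e * (n * η n)} ≤
      binomialProb n q {k | k < n * q + d * (n * η n)} := by
  have hv : 0 < p * (1 - p) := mul_pos hp0 (by linarith)
  have hR0 : 0 < R := by linarith
  rcases hde with ⟨hd, hed⟩ | ⟨hd, hed⟩
  -- The midpoint replaces `d`, which may be 0, because the lower tail estimate needs a strictly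
  -- negative deviation.
  · have hlt : (-((d + e) / 2)) ^ 2 / (2 * (q * (1 - q))) < (-e) ^ 2 / (2 * (p * (1 - p))) := by
      rw [hR2]
      have h1 : (-((d + e) / 2)) ^ 2 < (-e) ^ 2 := by nlinarith
      have h2 : p * (1 - p) ≤ R ^ 2 * (p * (1 - p)) :=
        le_mul_of_one_le_left hv.le (one_le_pow₀ hR.le)
      gcongr
    obtain ⟨A, hA1, hA2⟩ := exists_between hlt
    filter_upwards [h.le_lower_tail hq0 hq1 (c := -((d + e) / 2)) (by linarith) hA1,
      h.lower_tail_le hp0 hp1 (c := -e) (by linarith) hA2, h.pos] with n h1 h2 h3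
    refine (binomialProb_mono hp0.le hp1.le n fun k hk => ?_).trans (h2.trans (h1.trans
      (binomialProb_mono hq0.le hq1.le n fun k hk => ?_)))
    · simp only [Set.mem_ofPred_eq] at hk ⊢
      linarith
    · simp only [Set.mem_ofPred_eq] at hk ⊢
      have : 0 ≤ n * η n := by positivity
      nlinarith
  -- Raising `e` to a positive value keeps e'R < d and allows upper tail estimates; the claim then
  -- follows by complements.
  · set e' := max e (d / (2 * R)) with he'
    have he0 : 0 < e' := lt_max_of_lt_right (by positivity)
    have heR : e' * R < d := by
      rcases max_choice e (d / (2 * R)) with h1 | h1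
      · rw [he', h1]; exact hed
      · rw [he', h1]; field_simp; linarith
    have hlt : e' ^ 2 / (2 * (p * (1 - p))) < d ^ 2 / (2 * (q * (1 - q))) := by
      have h1 : (e' * R) ^ 2 < d ^ 2 := by gcongr
      rw [hR2, div_lt_div_iff₀ (by positivity) (by positivity)]
      nlinarith
    obtain ⟨A, hA1, hA2⟩ := exists_between hlt
    filter_upwards [h.le_upper_tail hp0 hp1 he0 hA1, h.upper_tail_le hq0 hq1 hd hA2, h.pos]
      with n h1 h2 h3
    have hc : ∀ (p x : ℝ), binomialProb n p {k | k < x} = 1 - binomialProb n p {k | x ≤ k} := by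
      intro p x
      rw [← binomialProb_compl n p {k | x ≤ k}, add_sub_cancel_left]
      congr 1
      ext; simp
    rw [hc, hc]
    refine sub_le_sub_left (h2.trans (h1.trans (binomialProb_mono hp0.le hp1.le n fun k hk => ?_))) _
    simp only [Set.mem_ofPred_eq] at hk ⊢
    have h4 : 0 ≤ n * η n := by positivity
    have h5 : e ≤ e' := le_max_left _ _
    nlinarith

lemma IsModerate.one_sub_binaryECP_le (h : IsModerate η) (ha : 0 < (a : ℝ)) (ha1 : (a : ℝ) < 1)
    (hb : 0 < (b : ℝ)) (hb1 : (b : ℝ) < 1) {R : ℝ} (hR : 0 < R)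
    (hR2 : (b * (1 - b) : ℝ) = R ^ 2 * (a * (1 - a))) (hΔ : Δ < 0) {A : ℝ}
    (hA : A < (-Δ / (R + 1)) ^ 2 / (2 * (a * (1 - a)))) :
    ∀ᶠ n : ℕ in atTop, 1 - binaryECP a b n (b - a + Δ * η n) ≤ Real.exp (-(A * (n * η n ^ 2))) := by
  have hv0 : 0 < -Δ / (R + 1) := div_pos (by linarith) (by linarith)
  have hvR : -Δ / (R + 1) * (R + 1) = -Δ := div_mul_cancel₀ _ (by linarith)
  generalize -Δ / (R + 1) = v at hA hv0 hvR
  obtain ⟨B, hAB, hB⟩ := exists_between hA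
  have hB' : B < (R * v) ^ 2 / (2 * (b * (1 - b))) := by
    rw [hR2, mul_pow, mul_left_comm, mul_div_mul_left _ _ (by positivity)]
    exact hB
  filter_upwards [h.upper_tail_le ha ha1 hv0 hB, h.lower_tail_le hb hb1 (by positivity) hB',
    eventually_const_mul_exp_le h.top hAB 2, eventually_gt_atTop 0] with n h1 h2 h3 hn
  have h4 := tail_sub_tail_le_binaryECP (a := a) (b := b) (t := b - a + Δ * η n) hn
    (x := n * a + v * (n * η n)) (y := n * b - R * v * (n * η n))
    (by linear_combination (n * η n) * hvR)
  have h5 := binomialProb_compl n b {k | (k : ℝ) ≤ n * b - R * v * (n * η n)}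
  have h6 : {k : ℕ | (k : ℝ) ≤ n * (b : ℝ) - R * v * (n * η n)}ᶜ =
      {k : ℕ | n * (b : ℝ) - R * v * (n * η n) < k} := by
    ext; simp
  rw [h6] at h5
  linarith

lemma IsModerate.le_one_sub_binaryECP (h : IsModerate η) (ha : 0 < (a : ℝ)) (hab : (a : ℝ) < b)
    (hb1 : (b : ℝ) < 1) {R : ℝ} (hR : 0 < R)
    (hR2 : (b * (1 - b) : ℝ) = R ^ 2 * (a * (1 - a))) (hΔ : Δ < 0) {A : ℝ}
    (hA : (-Δ / (R + 1)) ^ 2 / (2 * (a * (1 - a))) < A) :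
    ∀ᶠ n : ℕ in atTop, Real.exp (-(A * (n * η n ^ 2))) ≤ 1 - binaryECP a b n (b - a + Δ * η n) := by
  have ha1 : (a : ℝ) < 1 := by linarith
  have hb : 0 < (b : ℝ) := by linarith
  have hv0 : 0 < -Δ / (R + 1) := div_pos (by linarith) (by linarith)
  have hvR : -Δ / (R + 1) * (R + 1) = -Δ := div_mul_cancel₀ _ (by linarith)
  generalize -Δ / (R + 1) = v at hA hv0 hvR
  obtain ⟨B, hB, hAB⟩ := exists_between hA
  have hB' : (R * v) ^ 2 / (2 * (b * (1 - b))) < B := by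
    rw [hR2, mul_pow, mul_left_comm, mul_div_mul_left _ _ (by positivity)]
    exact hB
  filter_upwards [h.le_upper_tail ha ha1 hv0 hB, h.le_lower_tail hb hb1 (by positivity) hB',
    eventually_const_mul_exp_le h.top hAB 2, eventually_const_mul_exp_le h.top (lt_add_one B) 4,
    -- The events removing the absolute value have rate B + 1; with the factor 4 they cost at most
    -- half of the main term exp(-B nη²).
    h.linear_upper_tail_le ha ha1 (x := (a + b) / 2) (by linarith) (B + 1),
    h.linear_lower_tail_le hb hb1 (x := (a + b) / 2) (by linarith) (B + 1),
    eventually_gt_atTop 0] with n h1 h2 h3 h4 h5 h6 hn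
  have h7 := le_one_sub_binaryECP_of_countermonotone (a := a) (b := b) (t := b - a + Δ * η n) hn
    (x := n * a + v * (n * η n)) (y := n * b - R * v * (n * η n))
    (m := n * ((a + b) / 2)) (by linear_combination (-(n * η n)) * hvR)
  have h8 := le_min h1 h2
  linarith

lemma IsModerate.le_binaryECP (h : IsModerate η) (ha : 0 < (a : ℝ)) (ha1 : (a : ℝ) < 1)
    (hb : 0 < (b : ℝ)) (hb1 : (b : ℝ) < 1) {R : ℝ} (hR : 1 < R)
    (hR2 : (b * (1 - b) : ℝ) = R ^ 2 * (a * (1 - a))) (hΔ : 0 < Δ) {A : ℝ}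
    (hA : (Δ / (R - 1)) ^ 2 / (2 * (a * (1 - a))) < A) :
    ∀ᶠ n : ℕ in atTop, Real.exp (-(A * (n * η n ^ 2))) ≤ binaryECP a b n (b - a + Δ * η n) := by
  have hva : 0 < (a * (1 - a) : ℝ) := mul_pos ha (by linarith)
  have hR0 : 0 < R := by linarith
  have hv0 : 0 < Δ / (R - 1) := div_pos hΔ (by linarith)
  have hvR : Δ / (R - 1) * (R - 1) = Δ := div_mul_cancel₀ _ (by linarith)
  generalize Δ / (R - 1) = v at hA hv0 hvR
  -- At w = v the deviations Rw of Y and Rw - Δ = w of X have equal exponents; for w > v that of X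
  -- is strictly larger, so its tail can be subtracted.
  obtain ⟨w, hvw, hw⟩ : ∃ w, v < w ∧ w ^ 2 / (2 * (a * (1 - a) : ℝ)) < A := by
    have hc : Tendsto (fun w : ℝ => w ^ 2 / (2 * (a * (1 - a) : ℝ))) (𝓝[>] v)
        (𝓝 (v ^ 2 / (2 * (a * (1 - a))))) :=
      (Continuous.tendsto (by fun_prop) v).mono_left nhdsWithin_le_nhds
    obtain ⟨w, h1, h2⟩ := ((hc.eventually_lt_const hA).and self_mem_nhdsWithin).exists
    exact ⟨w, h2, h1⟩
  have hw0 : 0 < w := hv0.trans hvw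
  have hb2 : (R * w) ^ 2 / (2 * (b * (1 - b))) = w ^ 2 / (2 * (a * (1 - a) : ℝ)) := by
    rw [hR2, mul_pow, mul_left_comm, mul_div_mul_left _ _ (by positivity)]
  have hwΔ : w < R * w - Δ := by nlinarith
  have hlt : w ^ 2 / (2 * (a * (1 - a) : ℝ)) < (R * w - Δ) ^ 2 / (2 * (a * (1 - a))) := by gcongr
  obtain ⟨B, hB1, hB2⟩ := exists_between (lt_min hw hlt)
  obtain ⟨hBA, hB2⟩ := lt_min_iff.1 hB2
  obtain ⟨C, hBC, hC⟩ := exists_between hB2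
  filter_upwards [h.le_upper_tail hb hb1 (c := R * w) (by positivity) (by rwa [hb2]),
    h.upper_tail_le ha ha1 (hw0.trans hwΔ) hC,
    eventually_const_mul_exp_le h.top hBA 2, eventually_const_mul_exp_le h.top hBC 2,
    eventually_gt_atTop 0] with n h1 h2 h3 h4 hn
  have h5 := tail_sub_tail_le_binaryECP (a := a) (b := b) (t := b - a + Δ * η n) hn
    (x := n * a + (R * w - Δ) * (n * η n)) (y := n * b + R * w * (n * η n)) (by linarith)
  linarith

/-- The interval of radius `d * q` around `c` is covered by `N` cells of length `m * q`. -/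
lemma exists_grid_cell {c d m q Y : ℝ} {N : ℕ} (hm : 0 < m) (hN : N * m = 2 * d) (hq : 0 < q)
    (h0 : c - d * q < Y) (h1 : Y < c + d * q) :
    ∃ i < N, c + (-d + i * m) * q ≤ Y ∧ Y < c + (-d + i * m + m) * q := by
  obtain ⟨z, hz⟩ : ∃ z, (z - d) * q = Y - c :=
    ⟨(Y - c) / q + d, by rw [add_sub_cancel_right, div_mul_cancel₀ _ hq.ne']⟩
  have hz0 : 0 < z := by
    refine pos_of_mul_pos_left ?_ hq.le
    linarith
  have hz1 : z < 2 * d := by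
    refine lt_of_mul_lt_mul_right ?_ hq.le
    linarith
  have hf1 : (⌊z / m⌋₊ : ℝ) * m ≤ z := (le_div_iff₀ hm).1 (Nat.floor_le (by positivity))
  have hf2 : z < (⌊z / m⌋₊ + 1 : ℝ) * m := (div_lt_iff₀ hm).1 (Nat.lt_floor_add_one _)
  refine ⟨⌊z / m⌋₊, ?_, ?_, ?_⟩
  · rw [Nat.floor_lt (by positivity), div_lt_iff₀ hm, hN]
    exact hz1
  · have := mul_le_mul_of_nonneg_right hf1 hq.le
    linarith
  · have := mul_lt_mul_of_pos_right hf2 hq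
    linarith

lemma IsModerate.binaryECP_le (h : IsModerate η) (ha : 0 < (a : ℝ)) (hab : (a : ℝ) < b)
    (hb1 : (b : ℝ) < 1) {R : ℝ} (hR : 1 < R)
    (hR2 : (b * (1 - b) : ℝ) = R ^ 2 * (a * (1 - a))) (hΔ : 0 < Δ) {A : ℝ}
    (hA : A < (Δ / (R - 1)) ^ 2 / (2 * (a * (1 - a)))) :
    ∀ᶠ n : ℕ in atTop, binaryECP a b n (b - a + Δ * η n) ≤ Real.exp (-(A * (n * η n ^ 2))) := by
  have ha1 : (a : ℝ) < 1 := by linarith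
  have hb : 0 < (b : ℝ) := by linarith
  have hva : 0 < (a * (1 - a) : ℝ) := mul_pos ha (by linarith)
  have hR0 : 0 < R := by linarith
  have hv0 : 0 < Δ / (R - 1) := div_pos hΔ (by linarith)
  have hvR : Δ / (R - 1) * (R - 1) = Δ := div_mul_cancel₀ _ (by linarith)
  generalize Δ / (R - 1) = v at hA hv0 hvR
  -- Taking w < v leaves the slack `hgap` that pays for a positive mesh, while the tails of Y beyond
  -- Rw still have exponent above `A`.
  obtain ⟨w, hw0, hwv, hw⟩ : ∃ w, 0 < w ∧ w < v ∧ A < w ^ 2 / (2 * (a * (1 - a) : ℝ)) := by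
    have hc : Tendsto (fun w : ℝ => w ^ 2 / (2 * (a * (1 - a) : ℝ))) (𝓝[<] v)
        (𝓝 (v ^ 2 / (2 * (a * (1 - a))))) :=
      (Continuous.tendsto (by fun_prop) v).mono_left nhdsWithin_le_nhds
    obtain ⟨w, h1, h2, h3⟩ := ((hc.eventually_const_lt hA).and (Ioo_mem_nhdsLT hv0)).exists
    exact ⟨w, h2, h3, h1⟩
  obtain ⟨B, hAB, hB⟩ := exists_between hw
  have hb2 : (R * w) ^ 2 / (2 * (b * (1 - b))) = w ^ 2 / (2 * (a * (1 - a) : ℝ)) := by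
    rw [hR2, mul_pow, mul_left_comm, mul_div_mul_left _ _ (by positivity)]
  rw [← hb2] at hB
  have hd0 : 0 < R * w := by positivity
  have hgap : R * w * (R - 1) < Δ * R := by
    rw [← hvR, show R * w * (R - 1) = w * (R - 1) * R by ring]
    have : 0 < R - 1 := by linarith
    gcongr
  clear hb2
  generalize R * w = d at hB hd0 hgap
  -- the mesh of the grid
  obtain ⟨N, hN0, hN1, hN2⟩ : ∃ N : ℕ, 0 < N ∧ 2 * d / N < Δ ∧
      d * (R - 1) ≤ (Δ - 2 * d / N) * R := by
    have hc : Tendsto (fun N : ℕ => 2 * d / (N : ℝ)) atTop (𝓝 0) :=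
      tendsto_const_div_atTop_nhds_zero_nat _
    have hc2 := (hc.const_sub Δ).mul_const R
    rw [sub_zero] at hc2
    obtain ⟨N, h1, h2, h3⟩ := ((eventually_gt_atTop 0).and ((hc.eventually_lt_const hΔ).and
      (hc2.eventually_const_lt hgap))).exists
    exact ⟨N, h1, h2, h3.le⟩
  have hN0' : (0 : ℝ) < N := by exact_mod_cast hN0
  have hm0 : 0 < 2 * d / N := by positivity
  have hNm : N * (2 * d / N) = 2 * d := mul_div_cancel₀ _ hN0'.ne'
  generalize 2 * d / (N : ℝ) = m at hN1 hN2 hm0 hNm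
  have hcell : ∀ᶠ n : ℕ in atTop, ∀ i ∈ Finset.range N,
      binomialProb n a {k | (k : ℝ) < n * (a : ℝ) + (-d + i * m + m - Δ) * (n * η n)} ≤
        binomialProb n b {k | (k : ℝ) < n * (b : ℝ) + (-d + i * m) * (n * η n)} := by
    rw [eventually_all_finset]
    intro i hi
    refine h.lower_prob_le ha ha1 hb hb1 hR hR2 ?_
    -- Below the mean of Y a mesh smaller than Δ suffices; above it, (δ + m - Δ)R < δ is needed for
    -- every δ < d, which is how the mesh was chosen.
    rcases le_or_gt (-d + i * m) 0 with h1 | h1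
    · exact Or.inl ⟨h1, by linarith⟩
    · have hi' : (i : ℝ) + 1 ≤ N := by exact_mod_cast Finset.mem_range.1 hi
      have : (i + 1) * m ≤ N * m := by gcongr
      have h2 : -d + i * m < d := by nlinarith
      exact Or.inr ⟨h1, by nlinarith⟩
  filter_upwards [hcell, h.upper_tail_le hb hb1 hd0 hB, h.lower_tail_le hb hb1 hd0 hB,
    h.linear_upper_tail_le ha ha1 (x := (a + b) / 2) (by linarith) B,
    h.linear_lower_tail_le hb hb1 (x := (a + b) / 2) (by linarith) B,
    eventually_const_mul_exp_le h.top hAB 4, h.pos, eventually_gt_atTop 0]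
    with n hcell h1 h2 h3 h4 h5 hη hn
  have hn' : (0 : ℝ) < n := by exact_mod_cast hn
  have hnη : 0 < n * η n := by positivity
  have hba : 0 < (b : ℝ) - a := sub_pos.2 hab
  have h6 := binaryECP_le_of_comonotone (a := a) (b := b) (t := b - a + Δ * η n) hn
    (s := (Finset.range N : Set ℕ)) (m := n * ((a + b) / 2))
    (x := fun i : ℕ => (n : ℝ) * (a : ℝ) + (-d + i * m + m - Δ) * (n * η n))
    (y := fun i : ℕ => (n : ℝ) * (b : ℝ) + (-d + i * m) * (n * η n))
    (y₀ := n * b - d * (n * η n)) (y₁ := n * b + d * (n * η n)) hcell ?_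
  · linarith
  · intro X Y hY0 hY1 hXY
    obtain ⟨i, hi, h7, h8⟩ := exists_grid_cell hm0 hNm hnη hY0 hY1
    exact ⟨i, by simpa using hi, by linarith, h7⟩

end Rates

lemma isModerate_inv_sqrt {s : ℕ → ℝ} (hs_pos : ∀ n : ℕ, 1 ≤ n → 0 < s n)
    (hs_zero : Tendsto s atTop (𝓝 0))
    (hs_top : Tendsto (fun n : ℕ => (n : ℝ) * s n) atTop atTop) :
    IsModerate (fun n : ℕ => (√((n : ℝ) * s n))⁻¹) ∧
      ∀ᶠ n : ℕ in atTop, s n * (n * (√((n : ℝ) * s n))⁻¹ ^ 2) = 1 := by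
  have hpos : ∀ᶠ n : ℕ in atTop, 0 < (n : ℝ) ∧ 0 < s n := by
    filter_upwards [eventually_ge_atTop 1] with n hn
    exact ⟨by exact_mod_cast hn, hs_pos n hn⟩
  have heq : ∀ᶠ n : ℕ in atTop, n * (√((n : ℝ) * s n))⁻¹ ^ 2 = (s n)⁻¹ := by
    filter_upwards [hpos] with n ⟨h1, h2⟩
    rw [inv_pow, Real.sq_sqrt (by positivity)]
    field_simp
  refine ⟨⟨?_, ?_, ?_⟩, ?_⟩
  · filter_upwards [hpos] with n ⟨h1, h2⟩
    positivity
  · exact tendsto_inv_atTop_zero.comp (Real.tendsto_sqrt_atTop.comp hs_top)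
  · refine Tendsto.congr' (heq.mono fun _ h => h.symm) ?_
    refine tendsto_inv_nhdsGT_zero.comp (tendsto_nhdsWithin_iff.2 ⟨hs_zero, ?_⟩)
    exact hpos.mono fun _ h => h.2
  · filter_upwards [heq, hpos] with n h1 h2
    rw [h1, mul_inv_cancel₀ h2.2.ne']

end StrassenOT

open StrassenOT in
theorem corollary2 (a b : unitInterval) (ha : 0 < (a : ℝ)) (hab : (a : ℝ) < (b : ℝ))
    (hb : (b : ℝ) ≤ 1 / 2) (s : ℕ → ℝ) (hs_pos : ∀ n : ℕ, 1 ≤ n → 0 < s n)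
    (hs_zero : Tendsto s atTop (𝓝 0))
    (hs_top : Tendsto (fun n : ℕ => (n : ℝ) * s n) atTop atTop) (Δ : ℝ) :
    (Δ < 0 →
      Tendsto
        (fun n : ℕ => -s n * Real.log
          (1 - StrassenOT.binaryECP a b n ((b : ℝ) - (a : ℝ) + Δ / √((n : ℝ) * s n))))
        atTop
        (𝓝 ((-Δ / (√(((b : ℝ) - (b : ℝ) ^ 2) / ((a : ℝ) - (a : ℝ) ^ 2)) + 1)) ^ 2
          / (2 * ((a : ℝ) - (a : ℝ) ^ 2))))) ∧
    (0 < Δ →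
      Tendsto
        (fun n : ℕ => -s n * Real.log
          (StrassenOT.binaryECP a b n ((b : ℝ) - (a : ℝ) + Δ / √((n : ℝ) * s n))))
        atTop
        (𝓝 ((Δ / (√(((b : ℝ) - (b : ℝ) ^ 2) / ((a : ℝ) - (a : ℝ) ^ 2)) - 1)) ^ 2
          / (2 * ((a : ℝ) - (a : ℝ) ^ 2))))) := by
  obtain ⟨hη, hr⟩ := isModerate_inv_sqrt hs_pos hs_zero hs_top
  have hs : ∀ᶠ n in atTop, 0 < s n := by
    filter_upwards [eventually_ge_atTop 1] with n hn using hs_pos n hn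
  have ha1 : (a : ℝ) < 1 := by linarith
  have hb0 : 0 < (b : ℝ) := by linarith
  have hb1 : (b : ℝ) < 1 := by linarith
  have ea : (a : ℝ) - (a : ℝ) ^ 2 = a * (1 - a) := by ring
  have eb : (b : ℝ) - (b : ℝ) ^ 2 = b * (1 - b) := by ring
  have hva : 0 < (a * (1 - a) : ℝ) := mul_pos ha (by linarith)
  -- The difference is (b - a)(1 - a - b), positive since a < b ≤ 1/2.
  have hlt : (a * (1 - a) : ℝ) < b * (1 - b) := by nlinarith
  simp only [ea, eb, div_eq_mul_inv Δ √(_ * _)]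
  set R := √((b * (1 - b) : ℝ) / (a * (1 - a))) with hRd
  have hR : 1 < R := by
    rw [hRd, Real.lt_sqrt zero_le_one, one_pow, one_lt_div hva]
    exact hlt
  have hR2 : (b * (1 - b) : ℝ) = R ^ 2 * (a * (1 - a)) := by
    rw [hRd, Real.sq_sqrt (div_nonneg (hva.trans hlt).le hva.le), div_mul_cancel₀ _ hva.ne']
  have hR0 : 0 < R := by linarith
  exact ⟨fun hΔ => tendsto_neg_mul_log hs hr
      (fun A hA => hη.one_sub_binaryECP_le ha ha1 hb0 hb1 hR0 hR2 hΔ hA)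
      (fun A hA => hη.le_one_sub_binaryECP ha hab hb1 hR0 hR2 hΔ hA),
    fun hΔ => tendsto_neg_mul_log hs hr
      (fun A hA => hη.binaryECP_le ha hab hb1 hR hR2 hΔ hA)
      (fun A hA => hη.le_binaryECP ha ha1 hb0 hb1 hR hR2 hΔ hA)⟩
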